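/- Let $G$ be a finite simple maximal planar graph with at least three vertices (planar, and no edge can be added on the same vertex set without violating planarity). A 3-clique $k$ of $G$ is *separating* if the remaining vertices split into two non-empty parts such that every path from one part to the other meets $k$. Let $K$ be the set of 3-cliques of $G$. For every $k\in K$ let $G^k_{in}$ (interior) and $G^k_{out}$ (exterior) be the two parts into which the removal of $k$ divides $G$, the interior being the one with fewer vertices; both are non-empty if $k$ is separating, the interior is empty if $k$ is not separating, and if the two parts have equal order the choice of the interior is arbitrary (but fixed). All unions of subgraphs are the subgraphs of $G$ induced on the union of the vertex sets. Put $k_i\preceq_K k_j$ if $k_i\cup G^i_{in}\subseteq k_j\cup G^j_{in}$, and let $H$ be the directed graph on $K$ with an edge from $k_j$ to $k_i$ whenever $k_i$ covers $k_j$ in $(K,\preceq_K)$. Let $K'=K\cup\{k_{imag}\}$, where $k_{imag}$ is an imaginary 3-clique whose interior is $G$, and define $\preceq_{K'}$ on $K'$ by the same inclusion. For each $k_i\in K$ with at least one incoming edge in $H$, the bubble $b_i$ with root 3-clique $k_i$ is the union of $k_i$ and all its incoming neighbours in $H$; the bubble $b_\rho$, with root $k_{imag}$, is the union of all maximal elements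 of $(K,\preceq_K)$. Let $B'$ be the set of all these bubbles $b_i$ together with $b_\rho$, and put $b\preceq_{B'}b'$ if $k\preceq_{K'}k'$ for the roots $k,k'\in K'$ of $b,b'$. Theorem. Every $b\in B'$ has exactly one root in $K'$ (so $\preceq_{B'}$ is well defined), $(B',\preceq_{B'})$ is a partially ordered set, and $b_\rho$ is its one and only maximal element. -/

import Mathlib

namespace CliqueHierarchy

/-! ### Planarity through combinatorial embeddings -/

/-- A rotation system on `G`: a permutation of the darts (oriented edges) which, at every
vertex `v`, permutes the darts starting at `v` in one cycle. -/
structure RotationSystem {V : Type*} (G : SimpleGraph V) where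
  next : Equiv.Perm G.Dart
  fst_next : ∀ d, (next d).fst = d.fst
  sameCycle : ∀ d d' : G.Dart, d.fst = d'.fst → next.SameCycle d d'

/-- The face permutation: traverse the dart `u → v`, then leave `v` along the dart that
follows `v → u` in the rotation at `v`.  Its cycles are the boundary walks of the faces. -/
def RotationSystem.face {V : Type*} {G : SimpleGraph V} (R : RotationSystem G) :
    Equiv.Perm G.Dart :=
  SimpleGraph.Dart.symm_involutive.toPerm.trans R.next

/-- The number of faces of the embedding given by a rotation system, every connected component
being drawn on a sphere or surface of its own: the cycles of the face permutation, and
one face for every isolated vertex. -/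
noncomputable def RotationSystem.numFaces {V : Type*} {G : SimpleGraph V}
    (R : RotationSystem G) : ℕ :=
  Nat.card (Quotient (Equiv.Perm.SameCycle.setoid R.face)) +
    Nat.card {v : V // ∀ w, ¬ G.Adj v w}

/-- A finite graph is planar if it has a combinatorial embedding of genus `0`, i.e. a rotation
system with Euler characteristic `|V| - |E| + |F| = 2` on each component.  (On each component the
Euler characteristic is at most `2`, so it is enough to ask for the sum over all components.) -/
def IsPlanar {V : Type*} (G : SimpleGraph V) : Prop :=
  ∃ R : RotationSystem G,
    Nat.card V + R.numFaces = Nat.card G.edgeSet + 2 * Nat.card G.ConnectedComponent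

/-- A planar graph to which no edge can be added without violating planarity. -/
def IsMaximalPlanar {V : Type*} (G : SimpleGraph V) : Prop :=
  IsPlanar G ∧ ∀ u v : V, u ≠ v → ¬ G.Adj u v → ¬ IsPlanar (G ⊔ SimpleGraph.edge u v)

/-! ### 3-cliques, their interiors and exteriors -/

/-- The set `K` of 3-cliques of `G`. -/
abbrev Clique3 {V : Type*} (G : SimpleGraph V) : Type _ := {s : Finset V // G.IsNClique 3 s}

/-- The removal of `k` divides `G` into the parts `S` and `S'`: every path from `S` to `S'`
meets `k`. -/
structure Divides {V : Type*} (G : SimpleGraph V) (k : Finset V) (S S' : Set V) : Prop where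
  disjoint : Disjoint S S'
  union_eq : S ∪ S' = (k : Set V)ᶜ
  meets : ∀ i ∈ S, ∀ j ∈ S', ∀ p : G.Walk i j, ∃ v ∈ p.support, v ∈ k

/-- `k` is separating: its removal divides `G` into two non-empty parts. -/
def IsSeparating {V : Type*} (G : SimpleGraph V) (k : Finset V) : Prop :=
  ∃ S S' : Set V, S.Nonempty ∧ S'.Nonempty ∧ Divides G k S S'

/-- An assignment of an interior and an exterior to every 3-clique `k`: they are the two parts into
which the removal of `k` divides `G`, the interior being the one with the smaller order; for
parts of equal order the choice is arbitrary.  Both parts are non-empty if `k` is separating;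
if it is not, the interior is empty. -/
structure Orientation {V : Type*} (G : SimpleGraph V) where
  interior : Clique3 G → Set V
  exterior : Clique3 G → Set V
  divides : ∀ k, Divides G k.1 (interior k) (exterior k)
  nonempty : ∀ k, IsSeparating G k.1 → (interior k).Nonempty ∧ (exterior k).Nonempty
  card_le : ∀ k, (interior k).ncard ≤ (exterior k).ncard

namespace Orientation

variable {V : Type*} {G : SimpleGraph V} (o : Orientation G)

/-! ### The order on 3-cliques and the hierarchical graph -/

/-- The (induced) subgraph `k ∪ G_in` for a 3-clique `k`. -/
def closedInterior (k : Clique3 G) : G.Subgraph :=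
  (⊤ : G.Subgraph).induce ((k.1 : Set V) ∪ o.interior k)

/-- The relation `i ⪯_K j` on 3-cliques. -/
def le (i j : Clique3 G) : Prop := o.closedInterior i ≤ o.closedInterior j

/-- `x` covers `y` in `(K, ⪯_K)`, i.e. the hierarchical graph `H` has an edge from `y` to `x`. -/
def Covers (x y : Clique3 G) : Prop :=
  o.le y x ∧ y ≠ x ∧ ∀ z, o.le y z → o.le z x → z = y ∨ z = x

/-- The incoming neighbours of `k` in `H`. -/
def incoming (k : Clique3 G) : Set (Clique3 G) := {j | o.Covers k j}

/-- The maximal elements of `(K, ⪯_K)`. -/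
def maximalCliques : Set (Clique3 G) := {k | ∀ j, o.le k j → j = k}

/-! ### The imaginary 3-clique -/

/-- The subgraph `k ∪ G_in` for `k` in `K' = K ∪ {k_imag}`.  The imaginary 3-clique
`k_imag` is `none`, and its interior is all of `G`. -/
def closedInterior' : Option (Clique3 G) → G.Subgraph
  | none => ⊤
  | some k => o.closedInterior k

/-- The relation `i ⪯_{K'} j` on `K' = K ∪ {k_imag}`. -/
def le' (i j : Option (Clique3 G)) : Prop := o.closedInterior' i ≤ o.closedInterior' j

/-! ### Bubbles -/

/-- The graph union of a family of 3-cliques: the subgraph of `G` induced on the union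
of their vertex sets. -/
def graphUnion (A : Set (Clique3 G)) : G.Subgraph :=
  (⊤ : G.Subgraph).induce (⋃ k ∈ A, (k.1 : Set V))

/-- The bubble with root 3-clique `k`: the union of `k` and its incoming neighbours in `H`. -/
def bubble (k : Clique3 G) : G.Subgraph := graphUnion (insert k (o.incoming k))

/-- The bubble `b_ρ`: the union of the maximal 3-cliques. -/
def bubbleRho : G.Subgraph := graphUnion o.maximalCliques

/-- `r ∈ K'` is a root 3-clique of `b`: either `r = k_imag` and `b = b_ρ`, or `r` is
a 3-clique with an incoming edge in `H` and `b` is the bubble formed at `r`. -/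
def IsRoot : Option (Clique3 G) → G.Subgraph → Prop
  | none, b => b = o.bubbleRho
  | some k, b => (o.incoming k).Nonempty ∧ b = o.bubble k

/-- The set `B' = B ∪ {b_ρ}` of bubbles. -/
def bubbles : Set G.Subgraph :=
  {b | ∃ k, (o.incoming k).Nonempty ∧ b = o.bubble k} ∪ {o.bubbleRho}

/-- `b_ρ` as an element of `B'`. -/
def rho : o.bubbles := ⟨o.bubbleRho, Or.inr rfl⟩

/-- The relation `b ⪯_{B'} c`: the root 3-cliques are related by `⪯_{K'}`. -/
def bubbleLE (b c : o.bubbles) : Prop :=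
  ∃ r s : Option (Clique3 G), o.IsRoot r b.1 ∧ o.IsRoot s c.1 ∧ o.le' r s

end Orientation

end CliqueHierarchy

namespace CliqueHierarchy

/-! ### Cycles of permutations -/

/-! The theorem rests on the fact that two 3-cliques of a maximal planar graph do not cross. Its
source is a weak form of 3-connectedness (`exists_adj_of_closed`): a non-empty set cut off by a
3-clique has neighbours at all three of its vertices. Otherwise an edge could be added, either
between two consecutive neighbours of a vertex, across a corner of a face, or between two
components. That such an edge keeps the graph planar is a count of cycles of the face permutation:
the first kind splits a face in two; the second merges two faces and two components.

It follows that opposite sides of two distinct 3-cliques are nested (`side_subset`). With the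
interior never larger than the exterior, this makes inclusion of closed interiors antisymmetric
(`eq_of_mutual`), and closed interiors form a laminar family (`laminar`).

A bubble with a 3-clique as root contains that root, stays in its closed interior and is too large
to fit into a single 3-clique. Laminarity then excludes two incomparable roots, and the covering
relation excludes two comparable ones; a similar argument separates these bubbles from `b_ρ`
(`root_unique`). Thus the order on bubbles is inherited from inclusion on `K'`, where `k_imag` lies
above everything; so `b_ρ` is the greatest element and hence the only maximal one. -/

/-- Merging two classes of an equivalence relation lowers the number of classes by one. -/
theorem natCard_quotient_merge {α : Type*} [Finite α] (s t : Setoid α) {a b : α}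
    (hab : ¬ s a b)
    (h : ∀ x y, t x y ↔ s x y ∨ (s x a ∧ s y b) ∨ (s x b ∧ s y a)) :
    Nat.card (Quotient t) + 1 = Nat.card (Quotient s) := by
  classical
  let f : {q : Quotient s // q ≠ ⟦b⟧} → Quotient t := fun q =>
    Quotient.map id (fun x y hxy => (h x y).2 (Or.inl hxy)) q.1
  have hf : Function.Bijective f := by
    constructor
    · rintro ⟨x, hx⟩ ⟨y, hy⟩ hxy
      induction x using Quotient.inductionOn with | _ x
      induction y using Quotient.inductionOn with | _ y
      have hx' : ¬ s x b := fun h' => hx (Quotient.sound h')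
      have hy' : ¬ s y b := fun h' => hy (Quotient.sound h')
      have hxy' : t x y := Quotient.exact hxy
      rcases (h x y).1 hxy' with h' | h' | h'
      · exact Subtype.ext (Quotient.sound h')
      · exact absurd h'.2 hy'
      · exact absurd h'.1 hx'
    · intro y
      induction y using Quotient.inductionOn with | _ y
      by_cases hy : s y b
      · refine ⟨⟨⟦a⟧, fun h' => hab (Quotient.exact h')⟩, Quotient.sound ?_⟩
        exact (h a y).2 (Or.inr (Or.inl ⟨s.refl a, hy⟩))
      · exact ⟨⟨⟦y⟧, fun h' => hy (Quotient.exact h')⟩, rfl⟩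
  rw [← Nat.card_congr (Equiv.ofBijective f hf), ← Finite.card_option,
    Nat.card_congr (Equiv.optionSubtypeNe _)]

/-- The number of cycles of a permutation, fixed points included. -/
noncomputable def numCycles {α : Type*} (σ : Equiv.Perm α) : ℕ :=
  Nat.card (Quotient (Equiv.Perm.SameCycle.setoid σ))

/-- A property preserved by a permutation of a finite type holds on a whole cycle as soon as
it holds somewhere on it. -/
theorem sameCycle_induction {α : Type*} [Finite α] {σ : Equiv.Perm α} {P : α → Prop}
    (hP : ∀ x, P x → P (σ x)) {x y : α} (h : σ.SameCycle x y) (hx : P x) : P y := by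
  obtain ⟨n, rfl⟩ := h.exists_nat_pow_eq
  induction n with
  | zero => exact hx
  | succ n ih =>
    rw [pow_succ', Equiv.Perm.mul_apply]
    exact hP _ (ih ⟨n, by simp⟩)

/-- A relation that is an equivalence and relates `x` to `σ x` contains `SameCycle σ`. -/
theorem sameCycle_le_setoid {α : Type*} [Finite α] {σ : Equiv.Perm α} (r : Setoid α)
    (hr : ∀ x, r x (σ x)) {x y : α} (h : σ.SameCycle x y) : r x y :=
  sameCycle_induction (P := fun z => r x z) (fun z hz => r.trans hz (hr z)) h (r.refl x)

theorem eq_of_sameCycle_of_invariant {α β : Type*} [Finite α] {σ : Equiv.Perm α} (g : α → β)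
    (hg : ∀ x, g (σ x) = g x) {x y : α} (h : σ.SameCycle x y) : g x = g y :=
  sameCycle_le_setoid (Setoid.ker g) (fun x => (hg x).symm) h

theorem not_sameCycle_of_fixed {α : Type*} {σ : Equiv.Perm α} {a b : α} (hb : σ b = b)
    (hab : a ≠ b) : ¬ σ.SameCycle a b := fun h =>
  hab ((Equiv.Perm.SameCycle.symm h).eq_of_left hb).symm

/-- Multiplying by `swap a b` joins the cycles of `a` and `b` if these are distinct. -/
theorem sameCycle_mul_swap_self {α : Type*} [Finite α] [DecidableEq α] {σ : Equiv.Perm α}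
    {a b : α} (hab : ¬ σ.SameCycle a b) : (σ * Equiv.swap a b).SameCycle a b := by
  set τ := σ * Equiv.swap a b with hτ
  have hτb : τ b = σ a := by simp [hτ]
  -- Since `τ b = σ a` and `τ` agrees with `σ` off `a` and `b`, the `τ`-orbit of `b` follows the
  -- `σ`-cycle of `a`, which avoids `b`, until it reaches `a`.
  have key : ∀ y, σ.SameCycle (σ a) y → τ.SameCycle b y ∨ τ.SameCycle a b := by
    intro y hy
    refine (sameCycle_induction (σ := σ)
      (P := fun z => σ.SameCycle a z ∧ (τ.SameCycle b z ∨ τ.SameCycle a b)) ?_ hy ?_).2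
    · rintro z ⟨haz, hz⟩
      refine ⟨haz.apply_right, ?_⟩
      rcases hz with hz | hz
      · by_cases hza : z = a
        · exact Or.inr (hza ▸ hz.symm)
        · have hzb : z ≠ b := fun h => hab (h ▸ haz)
          have : τ z = σ z := by simp [hτ, Equiv.swap_apply_of_ne_of_ne hza hzb]
          exact Or.inl (this ▸ hz.apply_right)
      · exact Or.inr hz
    · exact ⟨(Equiv.Perm.SameCycle.refl σ a).apply_right,
        Or.inl (hτb ▸ (Equiv.Perm.SameCycle.refl τ b).apply_right)⟩
  rcases key a (Equiv.Perm.SameCycle.refl σ a).apply_left with h | h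
  · exact h.symm
  · exact h

theorem sameCycle_mul_swap_of_sameCycle {α : Type*} [Finite α] [DecidableEq α]
    {σ : Equiv.Perm α} {a b : α} (hab : ¬ σ.SameCycle a b) {x y : α} (h : σ.SameCycle x y) :
    (σ * Equiv.swap a b).SameCycle x y := by
  have hself := sameCycle_mul_swap_self hab
  set τ := σ * Equiv.swap a b with hτ
  refine sameCycle_le_setoid (Equiv.Perm.SameCycle.setoid τ) (fun z => ?_) h
  change τ.SameCycle z (σ z)
  by_cases hza : z = a
  · subst hza
    have : τ b = σ z := by simp [hτ]
    rw [← this]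
    exact hself.apply_right
  by_cases hzb : z = b
  · subst hzb
    have : τ a = σ z := by simp [hτ]
    rw [← this]
    exact hself.symm.apply_right
  have : τ z = σ z := by simp [hτ, Equiv.swap_apply_of_ne_of_ne hza hzb]
  rw [← this]
  exact (Equiv.Perm.SameCycle.refl τ z).apply_right

/-- The relation "same `σ`-cycle, once the cycles of `a` and `b` are identified" is preserved by `σ`
and by the swap, hence by their product; conversely the product keeps each `σ`-cycle together and
links `a` to `b`. -/
theorem numCycles_mul_swap {α : Type*} [Finite α] [DecidableEq α] {σ : Equiv.Perm α}
    {a b : α} (hab : ¬ σ.SameCycle a b) :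
    numCycles (σ * Equiv.swap a b) + 1 = numCycles σ := by
  have hself := sameCycle_mul_swap_self hab
  have hmono := fun x y => sameCycle_mul_swap_of_sameCycle (x := x) (y := y) hab
  refine natCard_quotient_merge _ _ (a := a) (b := b) hab fun x y => ⟨fun h => ?_, fun h => ?_⟩
  · let P : α → Prop := fun z => σ.SameCycle x z ∨
      (σ.SameCycle x a ∧ σ.SameCycle z b) ∨ (σ.SameCycle x b ∧ σ.SameCycle z a)
    refine sameCycle_induction (P := P) (fun z hz => ?_) h (Or.inl (.refl _ _))
    have hP : ∀ z, P z → P (σ z) := by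
      intro z hz
      simpa only [P, Equiv.Perm.sameCycle_apply_right, Equiv.Perm.sameCycle_apply_left] using hz
    rw [Equiv.Perm.mul_apply]
    apply hP
    by_cases hza : z = a
    · subst hza
      rw [Equiv.swap_apply_left]
      rcases hz with h1 | h1 | h1
      · exact Or.inr (Or.inl ⟨h1, .refl _ _⟩)
      · exact absurd h1.2 hab
      · exact Or.inl h1.1
    by_cases hzb : z = b
    · subst hzb
      rw [Equiv.swap_apply_right]
      rcases hz with h1 | h1 | h1
      · exact Or.inr (Or.inr ⟨h1, .refl _ _⟩)
      · exact Or.inl h1.1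
      · exact absurd h1.2.symm hab
    rwa [Equiv.swap_apply_of_ne_of_ne hza hzb]
  · rcases h with h | h | h
    · exact hmono x y h
    · exact (hmono _ _ h.1).trans (hself.trans (hmono _ _ h.2).symm)
    · exact (hmono _ _ h.1).trans (hself.symm.trans (hmono _ _ h.2).symm)

/-! ### Cycle counts under relabelling and added fixed points -/

theorem numCycles_permCongr {α β : Type*} (e : α ≃ β) (σ : Equiv.Perm α) :
    numCycles (e.permCongr σ) = numCycles σ := by
  refine (Nat.card_congr (Quotient.congr e fun x y => ?_)).symm
  change σ.SameCycle x y ↔ (e.permCongr σ).SameCycle (e x) (e y)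
  constructor
  · rintro ⟨n, hn⟩
    refine ⟨n, ?_⟩
    have := map_zpow e.permCongrHom σ n
    change e.permCongr (σ ^ n) = (e.permCongr σ) ^ n at this
    simp [← this, hn]
  · rintro ⟨n, hn⟩
    refine ⟨n, ?_⟩
    have := map_zpow e.permCongrHom σ n
    change e.permCongr (σ ^ n) = (e.permCongr σ) ^ n at this
    simpa [← this] using hn

theorem sameCycle_permCongr {α β : Type*} (e : α ≃ β) {σ : Equiv.Perm α} {x y : α}
    (h : σ.SameCycle x y) : (e.permCongr σ).SameCycle (e x) (e y) := by
  obtain ⟨n, hn⟩ := h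
  refine ⟨n, ?_⟩
  have := map_zpow e.permCongrHom σ n
  change e.permCongr (σ ^ n) = (e.permCongr σ) ^ n at this
  simp [← this, hn]

theorem sameCycle_sumCongr_inl {α β : Type*} {σ : Equiv.Perm α} {τ : Equiv.Perm β} {x y : α}
    (h : σ.SameCycle x y) : (Equiv.Perm.sumCongr σ τ).SameCycle (.inl x) (.inl y) := by
  obtain ⟨n, hn⟩ := h
  refine ⟨n, ?_⟩
  have := map_zpow (Equiv.Perm.sumCongrHom α β) (σ, τ) n
  change Equiv.Perm.sumCongr (σ ^ n) (τ ^ n) = (Equiv.Perm.sumCongr σ τ) ^ n at this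
  simp [← this, hn]

theorem numCycles_sumCongr_one {α β : Type*} [Finite α] [Finite β] (σ : Equiv.Perm α) :
    numCycles (Equiv.Perm.sumCongr σ (1 : Equiv.Perm β)) = numCycles σ + Nat.card β := by
  let g : α ⊕ β → Quotient (Equiv.Perm.SameCycle.setoid σ) ⊕ β := Sum.map Quotient.mk'' id
  have hg : ∀ x, g (Equiv.Perm.sumCongr σ (1 : Equiv.Perm β) x) = g x := by
    rintro (x | x)
    · exact congrArg Sum.inl (Quotient.sound' (Equiv.Perm.SameCycle.refl σ x).apply_left)
    · rfl
  let f : Quotient (Equiv.Perm.SameCycle.setoid (Equiv.Perm.sumCongr σ (1 : Equiv.Perm β))) →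
      Quotient (Equiv.Perm.SameCycle.setoid σ) ⊕ β :=
    Quotient.lift g fun x y hxy => eq_of_sameCycle_of_invariant g hg hxy
  have hf : Function.Bijective f := by
    constructor
    · intro x y hxy
      induction x using Quotient.inductionOn with | _ x
      induction y using Quotient.inductionOn with | _ y
      change g x = g y at hxy
      rcases x with x | x <;> rcases y with y | y
      · exact Quotient.sound (sameCycle_sumCongr_inl (Quotient.exact (Sum.inl_injective hxy)))
      · cases hxy
      · cases hxy
      · rw [show x = y from Sum.inr_injective hxy]
    · rintro (y | y)
      · induction y using Quotient.inductionOn with | _ y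
        exact ⟨⟦.inl y⟧, rfl⟩
      · exact ⟨⟦.inr y⟧, rfl⟩
  rw [numCycles, Nat.card_congr (Equiv.ofBijective f hf), Nat.card_sum, numCycles]

/-! ### Adding an edge to a rotation system -/

section AddEdge

open SimpleGraph Equiv

variable {V : Type*} {G : SimpleGraph V} {u v : V}

/-- The darts of `G ⊔ edge u v`: the darts of `G`, the dart `(u, v)` (as `inr true`) and the
dart `(v, u)` (as `inr false`). -/
noncomputable def dartEquiv (huv : u ≠ v) (hn : ¬ G.Adj u v) :
    G.Dart ⊕ Bool ≃ (G ⊔ edge u v).Dart :=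
  Equiv.ofBijective
    (Sum.elim (fun d => ⟨d.toProd, Or.inl d.adj⟩) fun b => bif b then
      ⟨(u, v), Or.inr ((edge_adj ..).2 ⟨Or.inl ⟨rfl, rfl⟩, huv⟩)⟩ else
      ⟨(v, u), Or.inr ((edge_adj ..).2 ⟨Or.inr ⟨rfl, rfl⟩, huv.symm⟩)⟩) <| by
    have hn' : ¬ G.Adj v u := fun h => hn h.symm
    constructor
    · rintro (⟨⟨a, b⟩, h⟩ | x) (⟨⟨a', b'⟩, h'⟩ | y) hxy
      · simpa using hxy
      · cases y <;> simp at hxy <;> obtain ⟨rfl, rfl⟩ := hxy <;> contradiction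
      · cases x <;> simp at hxy <;> obtain ⟨rfl, rfl⟩ := hxy <;> contradiction
      · cases x <;> cases y <;> simp_all
    · rintro ⟨⟨a, b⟩, h⟩
      rcases h with h | h
      · exact ⟨.inl ⟨(a, b), h⟩, rfl⟩
      · rcases (edge_adj ..).1 h with ⟨⟨rfl, rfl⟩ | ⟨rfl, rfl⟩, -⟩
        · exact ⟨.inr true, rfl⟩
        · exact ⟨.inr false, rfl⟩

/-- The initial vertex of a dart of `G ⊔ edge u v`. -/
def sumFst (u v : V) : G.Dart ⊕ Bool → V :=
  Sum.elim (fun d => d.fst) fun b => bif b then u else v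

theorem fst_dartEquiv (huv : u ≠ v) (hn : ¬ G.Adj u v) (x : G.Dart ⊕ Bool) :
    (dartEquiv huv hn x).fst = sumFst u v x := by
  rcases x with d | b
  · rfl
  · cases b <;> rfl

/-- Reversal of the darts of `G` on `G.Dart ⊕ Bool`, both new darts being fixed. -/
def sumRev : Perm (G.Dart ⊕ Bool) :=
  Perm.sumCongr SimpleGraph.Dart.symm_involutive.toPerm (1 : Perm Bool)

open Classical in
/-- Reversal of darts on `G.Dart ⊕ Bool`. -/
noncomputable def sumSymm : Perm (G.Dart ⊕ Bool) := sumRev * swap (.inr true) (.inr false)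

theorem dartEquiv_sumSymm (huv : u ≠ v) (hn : ¬ G.Adj u v) :
    (dartEquiv huv hn).permCongr sumSymm = SimpleGraph.Dart.symm_involutive.toPerm := by
  ext1 d
  obtain ⟨x, rfl⟩ := (dartEquiv huv hn).surjective d
  rw [Equiv.permCongr_apply, Equiv.symm_apply_apply]
  rcases x with d | b
  · simp [sumSymm, sumRev, swap_apply_of_ne_of_ne]
    rfl
  · cases b <;> simp [sumSymm, sumRev] <;> rfl

open Classical in
/-- The rotation on `G.Dart ⊕ Bool` in which `(u, v)` is inserted after `p` and `(v, u)` after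
the dart `q`. -/
noncomputable def sumNext (R : RotationSystem G) (p : G.Dart ⊕ Bool) (q : G.Dart) : Perm (G.Dart ⊕ Bool) :=
  Perm.sumCongr R.next (1 : Perm Bool) * swap p (.inr true) * swap (.inl q) (.inr false)

theorem invariant_swap {α β : Type*} [DecidableEq α] (g : α → β) {a b : α} (h : g a = g b)
    (x : α) : g (swap a b x) = g x := by
  by_cases hxa : x = a
  · subst hxa; simp [h]
  by_cases hxb : x = b
  · subst hxb; simp [h]
  rw [swap_apply_of_ne_of_ne hxa hxb]

/-- `p` is an admissible position for the dart `(u, v)`: either a dart at `u`, or `(u, v)` itself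
if `u` is isolated. -/
def IsPosition (u v : V) (p : G.Dart ⊕ Bool) : Prop :=
  sumFst u v p = u ∧ p ≠ .inr false ∧ (p = .inr true → ∀ w, ¬ G.Adj u w)

theorem sumFst_sumNext (R : RotationSystem G) {p : G.Dart ⊕ Bool} {q : G.Dart}
    (hp : IsPosition u v p) (hq : q.fst = v) (x : G.Dart ⊕ Bool) :
    sumFst u v (sumNext R p q x) = sumFst u v x := by
  classical
  have h0 : ∀ x, sumFst u v (Perm.sumCongr R.next (1 : Perm Bool) x) = sumFst u v x := by
    rintro (x | x)
    · exact R.fst_next x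
    · rfl
  rw [sumNext, Perm.mul_apply, Perm.mul_apply, h0,
    invariant_swap (sumFst u v) (show sumFst u v p = sumFst u v (.inr true) from hp.1),
    invariant_swap (sumFst u v) (show sumFst u v (.inl q) = sumFst u v (.inr false) from hq)]

theorem sumNext_sameCycle [Finite V] (R : RotationSystem G) (huv : u ≠ v)
    {p : G.Dart ⊕ Bool} {q : G.Dart} (hp : IsPosition u v p) (hq : q.fst = v)
    {x y : G.Dart ⊕ Bool} (h : sumFst u v x = sumFst u v y) :
    (sumNext R p q).SameCycle x y := by
  classical
  have : Finite G.Dart := Finite.of_injective _ SimpleGraph.Dart.toProd_injective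
  let N0 : Perm (G.Dart ⊕ Bool) := Perm.sumCongr R.next (1 : Perm Bool)
  let N1 := N0 * swap p (.inr true)
  let N2 := N1 * swap (.inl q) (.inr false)
  have hN : sumNext R p q = N2 := rfl
  rw [hN]
  have h1 : ∀ {x y}, N0.SameCycle x y → N1.SameCycle x y := by
    intro x y hxy
    by_cases hpe : p = .inr true
    · have hN1 : N1 = N0 := by
        simp only [N1, hpe, swap_self]
        exact mul_one N0
      rwa [hN1]
    · exact sameCycle_mul_swap_of_sameCycle (not_sameCycle_of_fixed rfl hpe) hxy
  have hfix : N1 (.inr false) = .inr false := by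
    simp only [N1, Perm.mul_apply]
    rw [swap_apply_of_ne_of_ne hp.2.1.symm (by simp)]
    rfl
  have hq' : ¬ N1.SameCycle (.inl q) (.inr false) := not_sameCycle_of_fixed hfix (by simp)
  have h2 : ∀ {x y : G.Dart ⊕ Bool}, N1.SameCycle x y → N2.SameCycle x y :=
    sameCycle_mul_swap_of_sameCycle hq'
  have hqe : N2.SameCycle (.inl q) (.inr false) := sameCycle_mul_swap_self hq'
  have hpe : N2.SameCycle p (.inr true) := by
    by_cases hpe : p = .inr true
    · rw [hpe]
    · exact h2 (sameCycle_mul_swap_self (not_sameCycle_of_fixed rfl hpe))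
  have hll : ∀ d d' : G.Dart, d.fst = d'.fst →
      N2.SameCycle (.inl d) (.inl d') := fun d d' hd =>
    h2 (h1 (sameCycle_sumCongr_inl (R.sameCycle d d' hd)))
  have hlr : ∀ (d : G.Dart) (b : Bool), d.fst = sumFst (G := G) u v (.inr b) →
      N2.SameCycle (.inl d) (.inr b) := by
    intro d b hd
    cases b with
    | false => exact (hll d q (hd.trans hq.symm)).trans hqe
    | true =>
      refine .trans ?_ hpe
      obtain ⟨hp1, hp2, hp3⟩ := hp
      rcases p with p | b
      · exact hll d p (hd.trans hp1.symm)
      · cases b with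
        | false => exact absurd rfl hp2
        | true =>
          have hadj := d.adj
          rw [show d.fst = u from hd] at hadj
          exact absurd hadj (hp3 rfl _)
  rcases x with d | b <;> rcases y with d' | b'
  · exact hll d d' h
  · exact hlr d b' h
  · exact (hlr d' b h.symm).symm
  · cases b <;> cases b'
    · exact .refl _ _
    · exact absurd h.symm huv
    · exact absurd h huv
    · exact .refl _ _

/-- The rotation system on `G ⊔ edge u v` in which `(u, v)` is inserted after `p` and `(v, u)`
after `q`. -/
noncomputable def RotationSystem.addEdge [Finite V] (R : RotationSystem G) (huv : u ≠ v)
    (hn : ¬ G.Adj u v) (p : G.Dart ⊕ Bool) (q : G.Dart) (hp : IsPosition u v p)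
    (hq : q.fst = v) : RotationSystem (G ⊔ edge u v) where
  next := (dartEquiv huv hn).permCongr (sumNext R p q)
  fst_next d := by
    obtain ⟨x, rfl⟩ := (dartEquiv huv hn).surjective d
    rw [Equiv.permCongr_apply, Equiv.symm_apply_apply, fst_dartEquiv, fst_dartEquiv,
      sumFst_sumNext R hp hq]
  sameCycle d d' h := by
    obtain ⟨x, rfl⟩ := (dartEquiv huv hn).surjective d
    obtain ⟨y, rfl⟩ := (dartEquiv huv hn).surjective d'
    rw [fst_dartEquiv, fst_dartEquiv] at h
    exact sameCycle_permCongr _ (sumNext_sameCycle R huv hp hq h)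

open Classical in
/-- The face permutation of `G` on `G.Dart ⊕ Bool`, with the new darts attached to the
boundary walks, but each closed up on its own. -/
noncomputable def preFace (R : RotationSystem G) (p : G.Dart ⊕ Bool) (q : G.Dart) :
    Perm (G.Dart ⊕ Bool) :=
  Perm.sumCongr R.face (1 : Perm Bool) * swap (sumRev p) (.inr true) *
    swap (.inl q.symm) (.inr false)

-- The new face permutation is rotation after reversal. Moving the two insertion swaps past `sumRev`
-- replaces `p` and `q` by their reversals, which gives `preFace`; the exchange of the two new darts
-- remains as a final swap.
open Classical in
theorem numCycles_face_addEdge [Finite V] (R : RotationSystem G) (huv : u ≠ v)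
    (hn : ¬ G.Adj u v) (p : G.Dart ⊕ Bool) (q : G.Dart) (hp : IsPosition u v p)
    (hq : q.fst = v) :
    numCycles (R.addEdge huv hn p q hp hq).face =
      numCycles (preFace R p q * swap (.inr true) (.inr false)) := by
  rw [← numCycles_permCongr (dartEquiv huv hn)]
  congr 1
  have h1 : (R.addEdge huv hn p q hp hq).face =
      (dartEquiv huv hn).permCongr (sumNext R p q * sumSymm) := by
    rw [RotationSystem.face, ← dartEquiv_sumSymm huv hn]
    ext1 x
    simp [RotationSystem.addEdge]
  rw [h1]
  congr 1
  have hface : Perm.sumCongr R.face (1 : Perm Bool) =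
      Perm.sumCongr R.next (1 : Perm Bool) * sumRev := by
    ext1 x
    rcases x with x | x <;> rfl
  have hinv : ∀ x : G.Dart ⊕ Bool, sumRev (sumRev x) = x := by
    rintro (x | x)
    · simp [sumRev]
    · rfl
  have hs : ∀ a b : G.Dart ⊕ Bool, sumRev * swap (sumRev a) (sumRev b) = swap a b * sumRev := by
    intro a b
    rw [Equiv.mul_swap_eq_swap_mul, hinv, hinv]
  have hs1 := hs p (.inr true)
  have hs2 := hs (.inl q) (.inr false)
  change sumRev * swap (sumRev p) (.inr true) = _ at hs1
  change sumRev * swap (.inl q.symm) (.inr false) = _ at hs2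
  rw [sumSymm, sumNext, preFace, hface]
  simp only [mul_assoc]
  congr 1
  rw [← mul_assoc sumRev (swap (sumRev p) _), hs1, mul_assoc, ← mul_assoc sumRev (swap _ _), hs2,
    mul_assoc]

theorem sumRev_eq_inr_iff {p : G.Dart ⊕ Bool} {b : Bool} : sumRev p = .inr b ↔ p = .inr b := by
  rcases p with p | c <;> simp [sumRev]

-- The new darts start as two extra fixed points, and each insertion merges one of them into another
-- cycle. For `p = .inr true` the first insertion is trivial, so one fixed point survives: it stands
-- for the face of the isolated vertex `u`.
open Classical in
theorem numCycles_preFace [Finite V] (R : RotationSystem G) (p : G.Dart ⊕ Bool) (q : G.Dart)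
    (hp : p ≠ .inr false) :
    numCycles (preFace R p q) + (if p = .inr true then 0 else 1) = numCycles R.face + 1 := by
  have : Finite G.Dart := Finite.of_injective _ SimpleGraph.Dart.toProd_injective
  have h0 := numCycles_sumCongr_one (β := Bool) R.face
  rw [Nat.card_eq_fintype_card, Fintype.card_bool] at h0
  set N0 : Perm (G.Dart ⊕ Bool) := Perm.sumCongr R.face (1 : Perm Bool)
  have hfix : (N0 * swap (sumRev p) (.inr true)) (.inr false) = .inr false := by
    rw [Perm.mul_apply,
      swap_apply_of_ne_of_ne (fun h => hp (sumRev_eq_inr_iff.1 h.symm)) (by simp)]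
    rfl
  have h2 : numCycles (preFace R p q) + 1 = numCycles (N0 * swap (sumRev p) (.inr true)) :=
    numCycles_mul_swap (not_sameCycle_of_fixed hfix (by simp))
  by_cases hpe : p = .inr true
  · rw [if_pos hpe]
    rw [sumRev_eq_inr_iff.2 hpe, swap_self] at h2
    change _ = numCycles (N0 * 1) at h2
    rw [mul_one] at h2
    omega
  · rw [if_neg hpe]
    have h1 : numCycles (N0 * swap (sumRev p) (.inr true)) + 1 = numCycles N0 :=
      numCycles_mul_swap (not_sameCycle_of_fixed rfl fun h => hpe (sumRev_eq_inr_iff.1 h))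
    omega

/-! ### Edges, components and isolated vertices after adding an edge -/

theorem natCard_edgeSet_sup_edge [Finite V] (huv : u ≠ v) (hn : ¬ G.Adj u v) :
    Nat.card (G ⊔ edge u v).edgeSet = Nat.card G.edgeSet + 1 := by
  classical
  have : Fintype V := Fintype.ofFinite V
  rw [Nat.card_eq_fintype_card, Nat.card_eq_fintype_card, ← SimpleGraph.edgeFinset_card,
    ← SimpleGraph.edgeFinset_card]
  exact G.card_edgeFinset_sup_edge hn huv

theorem reachable_sup_edge_iff (huv : u ≠ v) {x y : V} :
    (G ⊔ edge u v).Reachable x y ↔ G.Reachable x y ∨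
      (G.Reachable x u ∧ G.Reachable y v) ∨ (G.Reachable x v ∧ G.Reachable y u) := by
  have hle : G ≤ G ⊔ edge u v := le_sup_left
  have huv' : (G ⊔ edge u v).Reachable u v :=
    SimpleGraph.Adj.reachable (Or.inr ((edge_adj ..).2 ⟨Or.inl ⟨rfl, rfl⟩, huv⟩))
  constructor
  · rintro ⟨w⟩
    induction w with
    | nil => exact Or.inl (.refl _)
    | @cons a b c h w ih =>
      rcases h with h | h
      · have hab : G.Reachable a b := h.reachable
        rcases ih with ih | ih | ih
        · exact Or.inl (hab.trans ih)
        · exact Or.inr (Or.inl ⟨hab.trans ih.1, ih.2⟩)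
        · exact Or.inr (Or.inr ⟨hab.trans ih.1, ih.2⟩)
      · rcases (edge_adj ..).1 h with ⟨⟨rfl, rfl⟩ | ⟨rfl, rfl⟩, -⟩
        · rcases ih with ih | ih | ih
          · exact Or.inr (Or.inl ⟨.refl _, ih.symm⟩)
          · exact Or.inr (Or.inl ⟨.refl _, ih.2⟩)
          · exact Or.inl ih.2.symm
        · rcases ih with ih | ih | ih
          · exact Or.inr (Or.inr ⟨.refl _, ih.symm⟩)
          · exact Or.inl ih.2.symm
          · exact Or.inr (Or.inr ⟨.refl _, ih.2⟩)
  · rintro (h | h | h)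
    · exact h.mono hle
    · exact (h.1.mono hle).trans (huv'.trans (h.2.mono hle).symm)
    · exact (h.1.mono hle).trans (huv'.symm.trans (h.2.mono hle).symm)

theorem natCard_connectedComponent_sup_edge_of_reachable (huv : u ≠ v)
    (h : G.Reachable u v) :
    Nat.card (G ⊔ edge u v).ConnectedComponent = Nat.card G.ConnectedComponent := by
  refine Nat.card_congr (Quot.congrRight fun x y => ?_)
  rw [reachable_sup_edge_iff huv]
  refine ⟨?_, Or.inl⟩
  rintro (h' | h' | h')
  · exact h'
  · exact h'.1.trans (h.trans h'.2.symm)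
  · exact h'.1.trans (h.symm.trans h'.2.symm)

theorem natCard_connectedComponent_sup_edge_of_not_reachable [Finite V] (huv : u ≠ v)
    (h : ¬ G.Reachable u v) :
    Nat.card (G ⊔ edge u v).ConnectedComponent + 1 = Nat.card G.ConnectedComponent :=
  natCard_quotient_merge G.reachableSetoid (G ⊔ edge u v).reachableSetoid h
    fun _ _ => reachable_sup_edge_iff huv

theorem natCard_isolated_sup_edge [Finite V] (huv : u ≠ v) (hv : ∃ w, G.Adj v w)
    [Decidable (∀ w, ¬ G.Adj u w)] :
    Nat.card {x : V // ∀ w, ¬ (G ⊔ edge u v).Adj x w} +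
      (if ∀ w, ¬ G.Adj u w then 1 else 0) = Nat.card {x : V // ∀ w, ¬ G.Adj x w} := by
  have key : ∀ x, (∀ w, ¬ (G ⊔ edge u v).Adj x w) ↔ (∀ w, ¬ G.Adj x w) ∧ x ≠ u := by
    intro x
    constructor
    · intro h
      refine ⟨fun w hw => h w (Or.inl hw), ?_⟩
      rintro rfl
      exact h v (Or.inr ((edge_adj ..).2 ⟨Or.inl ⟨rfl, rfl⟩, huv⟩))
    · rintro ⟨h, hx⟩ w (hw | hw)
      · exact h w hw
      · rcases (edge_adj ..).1 hw with ⟨⟨rfl, rfl⟩ | ⟨rfl, rfl⟩, -⟩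
        · exact hx rfl
        · obtain ⟨w, hw⟩ := hv
          exact h w hw
  simp_rw [key]
  change Set.ncard {x | (∀ w, ¬ G.Adj x w) ∧ x ≠ u} + _ = Set.ncard {x | ∀ w, ¬ G.Adj x w}
  have hset : {x | (∀ w, ¬ G.Adj x w) ∧ x ≠ u} = {x | ∀ w, ¬ G.Adj x w} \ {u} := rfl
  rw [hset]
  split_ifs with h
  · exact Set.ncard_sdiff_singleton_add_one h (Set.toFinite _)
  · rw [Set.sdiff_singleton_eq_self (by exact h), add_zero]

/-- Two vertices which are consecutive neighbours of a third one can be joined. -/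
theorem isPlanar_sup_edge_of_consecutive [Finite V] (R : RotationSystem G)
    (hR : Nat.card V + R.numFaces = Nat.card G.edgeSet + 2 * Nat.card G.ConnectedComponent)
    (d : G.Dart) (huv : d.snd ≠ (R.next d).snd) (hn : ¬ G.Adj d.snd (R.next d).snd) :
    IsPlanar (G ⊔ edge d.snd (R.next d).snd) := by
  classical
  have : Finite G.Dart := Finite.of_injective _ SimpleGraph.Dart.toProd_injective
  have hface : ∀ d, R.face d = R.next d.symm := fun _ => rfl
  have hfst : (R.next d).fst = d.fst := R.fst_next d
  -- `r.symm` precedes `d.symm` in the rotation at `d.snd`; inserting the new dart between them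
  -- places it in the corner next to `d`.
  obtain ⟨r, hr⟩ : ∃ r, R.face r = d.symm := R.face.surjective _
  have hrs : r.snd = d.snd := by
    have := congrArg (fun x : G.Dart => x.fst) hr
    simpa [hface, R.fst_next] using this
  set q := (R.next d).symm with hqdef
  have hp : IsPosition d.snd (R.next d).snd (.inl r.symm : G.Dart ⊕ Bool) :=
    ⟨hrs, by simp, by simp⟩
  have hq : q.fst = (R.next d).snd := rfl
  refine ⟨R.addEdge huv hn _ q hp hq, ?_⟩
  have h1 := numCycles_preFace R (.inl r.symm) q (by simp)
  rw [if_neg (by simp)] at h1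
  have h2 := numCycles_face_addEdge R huv hn _ q hp hq
  set σ := preFace R (.inl r.symm) q * swap (.inr true) (.inr false) with hσ
  -- The cycle of `.inr false` is the triangle `.inr false`, `d.symm`, `R.next d`, which misses
  -- `.inr true`: the new edge has different faces on its two sides.
  have hns : ¬ σ.SameCycle (.inr false) (.inr true) := by
    intro hs
    have hpre : ∀ x, preFace R (.inl r.symm) q x = Perm.sumCongr R.face (1 : Perm Bool)
        (swap (.inl r) (.inr true) (swap (.inl (R.next d)) (.inr false) x)) := by
      intro x
      have h' : (sumRev (.inl r.symm) : G.Dart ⊕ Bool) = .inl r := by simp [sumRev]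
      rw [preFace, h', hqdef, SimpleGraph.Dart.symm_symm]
      rfl
    have hsw : ∀ (a : G.Dart) (b : Bool) (x : G.Dart ⊕ Bool), x ≠ .inl a → x ≠ .inr b →
        swap (.inl a) (.inr b) x = x := fun _ _ _ => swap_apply_of_ne_of_ne
    have hadj := d.adj.ne
    have := sameCycle_induction (σ := σ)
      (P := fun x => x = .inr false ∨ x = .inl d.symm ∨ x = .inl (R.next d)) ?_ hs (Or.inl rfl)
    · simp at this
    · rintro x (rfl | rfl | rfl)
      · right; left
        rw [hσ, Perm.mul_apply, swap_apply_right, hpre,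
          hsw (R.next d) _ _ (by simp) (by simp), swap_apply_right]
        simp [hr]
      · right; right
        have e1 : d.symm ≠ R.next d := by
          intro h
          have : d.snd = (R.next d).fst := congrArg (fun x : G.Dart => x.fst) h
          exact hadj (this.trans hfst).symm
        have e2 : d.symm ≠ r := by
          intro h
          have := congrArg (fun x : G.Dart => x.snd) h
          exact hadj (this.trans hrs)
        rw [hσ, Perm.mul_apply, swap_apply_of_ne_of_ne (by simp) (by simp), hpre,
          hsw (R.next d) _ _ (by simpa using e1) (by simp),
          hsw r _ _ (by simpa using e2) (by simp)]
        simp [hface]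
      · left
        rw [hσ, Perm.mul_apply, swap_apply_of_ne_of_ne (by simp) (by simp), hpre,
          swap_apply_left, swap_apply_of_ne_of_ne (by simp) (by simp)]
        rfl
  -- Multiplying `σ` by the swap again gives back `preFace`, so `σ` has one cycle more than
  -- `preFace`.
  have h3 := numCycles_mul_swap hns
  rw [hσ, swap_comm (.inr false : G.Dart ⊕ Bool) (.inr true), mul_assoc, swap_mul_self, mul_one,
    ← hσ] at h3
  have hreach : G.Reachable d.snd (R.next d).snd :=
    d.adj.symm.reachable.trans (hfst ▸ (R.next d).adj.reachable)
  have h4 := natCard_connectedComponent_sup_edge_of_reachable huv hreach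
  have h5 := natCard_edgeSet_sup_edge huv hn
  have h6 := natCard_isolated_sup_edge (G := G) huv ⟨_, (R.next d).adj.symm⟩
  rw [if_neg (fun h => h _ d.adj.symm)] at h6
  rw [RotationSystem.numFaces] at hR ⊢
  rw [numCycles] at h2
  change Nat.card V + (numCycles R.face + _) = _ at hR
  rw [h2, h4, h5]
  omega

/-- A non-isolated vertex can be joined to any vertex of another component. -/
theorem isPlanar_sup_edge_of_not_reachable [Finite V] (hG : IsPlanar G)
    (h : ¬ G.Reachable u v) (hv : ∃ w, G.Adj v w) : IsPlanar (G ⊔ edge u v) := by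
  classical
  have : Finite G.Dart := Finite.of_injective _ SimpleGraph.Dart.toProd_injective
  obtain ⟨R, hR⟩ := hG
  have huv : u ≠ v := fun h' => h (h' ▸ .refl _)
  have hn : ¬ G.Adj u v := fun h' => h h'.reachable
  have h6 := natCard_isolated_sup_edge (G := G) huv hv
  obtain ⟨w, hw⟩ := hv
  let q : G.Dart := ⟨(v, w), hw⟩
  have hq : q.fst = v := rfl
  obtain ⟨p, hp, hpu⟩ : ∃ p : G.Dart ⊕ Bool, IsPosition u v p ∧
      (p = .inr true ↔ ∀ w, ¬ G.Adj u w) := by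
    by_cases hu : ∀ w, ¬ G.Adj u w
    · exact ⟨.inr true, ⟨rfl, by simp, fun _ => hu⟩, by simpa using hu⟩
    · obtain ⟨w', hw'⟩ := not_forall_not.1 hu
      exact ⟨.inl ⟨(u, w'), hw'⟩, ⟨rfl, by simp, by simp⟩, by simpa using ⟨w', hw'⟩⟩
  refine ⟨R.addEdge huv hn p q hp hq, ?_⟩
  have h1 := numCycles_preFace R p q hp.2.1
  have h2 := numCycles_face_addEdge R huv hn p q hp hq
  have hns : ¬ (preFace R p q).SameCycle (.inr true) (.inr false) := by
    intro hs
    -- The component of the initial vertex is constant on cycles of `preFace`, and the two new darts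
    -- start in different components.
    let g : G.Dart ⊕ Bool → G.ConnectedComponent := fun x => G.connectedComponentMk (sumFst u v x)
    have hrev : ∀ x, g (sumRev x) = g x := by
      rintro (x | x)
      · exact SimpleGraph.ConnectedComponent.sound x.adj.symm.reachable
      · rfl
    have hg : ∀ x, g (preFace R p q x) = g x := by
      intro x
      have h0 : ∀ x, g (Perm.sumCongr R.face (1 : Perm Bool) x) = g x := by
        rintro (x | x)
        · refine SimpleGraph.ConnectedComponent.sound ?_
          change G.Reachable (R.next x.symm).fst x.fst
          rw [R.fst_next]
          exact x.adj.symm.reachable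
        · rfl
      rw [preFace, Perm.mul_apply, Perm.mul_apply, h0,
        invariant_swap g (a := sumRev p) (b := .inr true)
          ((hrev p).trans (congrArg G.connectedComponentMk hp.1)),
        invariant_swap g (a := .inl q.symm) (b := .inr false) (hrev (.inl q))]
    exact h (SimpleGraph.ConnectedComponent.exact (eq_of_sameCycle_of_invariant g hg hs))
  have h3 := numCycles_mul_swap hns
  have h4 := natCard_connectedComponent_sup_edge_of_not_reachable huv h
  have h5 := natCard_edgeSet_sup_edge huv hn
  rw [RotationSystem.numFaces] at hR ⊢
  rw [numCycles] at h2
  change Nat.card V + (numCycles R.face + _) = _ at hR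
  rw [h2, h5]
  by_cases hu : ∀ w, ¬ G.Adj u w
  · rw [if_pos hu] at h6
    rw [if_pos (hpu.2 hu)] at h1
    omega
  · rw [if_neg hu] at h6
    rw [if_neg (mt hpu.1 hu)] at h1
    omega

end AddEdge

open SimpleGraph

variable {V : Type*} {G : SimpleGraph V}

/-! ### Three-connectedness of maximal planar graphs -/

/-- In a maximal planar graph, two vertices `x`, `y` which are separated by the edge `ab` cannot
both be neighbours of `a`. -/
theorem IsMaximalPlanar.not_adj_of_closed [Finite V] (hG : IsMaximalPlanar G) {a b x y : V}
    {D : Set V} (hab : G.Adj a b) (haD : a ∉ D) (hbD : b ∉ D)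
    (hD : ∀ i ∈ D, ∀ j, G.Adj i j → j ∈ D ∨ j = a ∨ j = b) (hx : x ∈ D) (hax : G.Adj a x)
    (hy : y ∉ D) (hyb : y ≠ b) : ¬ G.Adj a y := by
  intro hay
  have : Finite G.Dart := Finite.of_injective _ SimpleGraph.Dart.toProd_injective
  obtain ⟨R, hR⟩ := hG.1
  -- Consecutive neighbours of `a` on different sides of `D` would be non-adjacent and could be
  -- joined, against maximality. Membership in `D` can thus change only at `b`.
  have key : ∀ d : G.Dart, d.fst = a → d.snd ≠ b → (R.next d).snd ≠ b →
      (d.snd ∈ D ↔ (R.next d).snd ∈ D) := by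
    intro d hda hdb hnb
    by_contra hne
    have hna : (R.next d).fst = a := (R.fst_next d).trans hda
    have h1 : d.snd ≠ a := fun h => d.adj.ne (hda.trans h.symm)
    have h2 : (R.next d).snd ≠ a := fun h => (R.next d).adj.ne (hna.trans h.symm)
    have hneq : d.snd ≠ (R.next d).snd := fun h => hne (by rw [h])
    have hnadj : ¬ G.Adj d.snd (R.next d).snd := by
      intro h
      by_cases hd : d.snd ∈ D
      · rcases hD _ hd _ h with h' | h' | h'
        · exact hne (iff_of_true hd h')
        · exact h2 h'
        · exact hnb h'
      · by_cases hd' : (R.next d).snd ∈ D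
        · rcases hD _ hd' _ h.symm with h' | h' | h'
          · exact hd h'
          · exact h1 h'
          · exact hdb h'
        · exact hne (iff_of_false hd hd')
    exact hG.2 _ _ hneq hnadj (isPlanar_sup_edge_of_consecutive R hR d hneq hnadj)
  let β : G.Dart := ⟨(a, b), hab⟩
  have hβ : ∀ d : G.Dart, d.fst = a → d.snd = b → d = β := by
    rintro ⟨⟨p, q⟩, h⟩ rfl rfl
    rfl
  -- The dart to `b` occurs only once in the rotation at `a`, so all the other darts form one run
  -- with constant membership in `D`.
  have all : ∀ d : G.Dart, d.fst = a →
      d.fst = a ∧ (d = β ∨ (d.snd ∈ D ↔ (R.next β).snd ∈ D)) := by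
    intro d hd
    refine sameCycle_induction (σ := R.next)
      (P := fun d => d.fst = a ∧ (d = β ∨ (d.snd ∈ D ↔ (R.next β).snd ∈ D)))
      (fun z hz => ?_) (R.sameCycle β d hd.symm)
      ⟨rfl, Or.inl rfl⟩
    have hza : (R.next z).fst = a := (R.fst_next z).trans hz.1
    refine ⟨hza, ?_⟩
    by_cases hzβ : z = β
    · subst hzβ
      exact Or.inr Iff.rfl
    · by_cases hzb : (R.next z).snd = b
      · exact Or.inl (hβ _ hza hzb)
      · have h' := hz.2.resolve_left hzβ
        exact Or.inr ((key z hz.1 (fun h => hzβ (hβ z hz.1 h)) hzb).symm.trans h')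
  have hdx := (all ⟨(a, x), hax⟩ rfl).2.resolve_left fun h => by
    have : x = b := congrArg (fun d : G.Dart => d.snd) h
    exact hbD (this ▸ hx)
  have hdy := (all ⟨(a, y), hay⟩ rfl).2.resolve_left fun h =>
    hyb (congrArg (fun d : G.Dart => d.snd) h)
  exact hy (hdy.2 (hdx.1 hx))

/-- In a maximal planar graph, if a non-empty vertex set `D` disjoint from a 3-clique `k` has no
neighbours outside `D ∪ k`, then every vertex of `k` has a neighbour in `D`. -/
theorem IsMaximalPlanar.exists_adj_of_closed [Finite V] (hG : IsMaximalPlanar G) (k : Clique3 G)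
    {D : Set V} (hne : D.Nonempty) (hdisj : ∀ i ∈ D, i ∉ k.1)
    (hD : ∀ i ∈ D, ∀ j, G.Adj i j → j ∈ D ∨ j ∈ k.1) {c : V} (hc : c ∈ k.1) :
    ∃ x ∈ D, G.Adj c x := by
  classical
  by_contra! hcD
  have hcl : ∀ i ∈ k.1, ∀ j ∈ k.1, i ≠ j → G.Adj i j := fun i hi j hj h =>
    k.2.isClique hi hj h
  -- If some `a` in `k` has a neighbour in `D` while `c` has none, then `a` and the third vertex `b`
  -- already separate `D` from `c`, although `a` has neighbours on both sides. If no vertex of `k`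
  -- has one, `D` is a union of components and can be linked to `c`.
  by_cases hN : ∃ a ∈ k.1, ∃ x ∈ D, G.Adj a x
  · obtain ⟨a, ha, x, hx, hax⟩ := hN
    have hac : a ≠ c := fun h => hcD x hx (h ▸ hax)
    obtain ⟨b, hb, hba, hbc, hk⟩ : ∃ b ∈ k.1, b ≠ a ∧ b ≠ c ∧
        ∀ j ∈ k.1, j = a ∨ j = b ∨ j = c := by
      have hcard := k.2.card_eq
      have h1 : ((k.1.erase a).erase c).card = 1 := by
        rw [Finset.card_erase_of_mem (Finset.mem_erase.2 ⟨hac.symm, hc⟩),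
          Finset.card_erase_of_mem ha, hcard]
      obtain ⟨b, hb⟩ := Finset.card_eq_one.1 h1
      have hbm : b ∈ (k.1.erase a).erase c := hb ▸ Finset.mem_singleton_self b
      rw [Finset.mem_erase, Finset.mem_erase] at hbm
      refine ⟨b, hbm.2.2, hbm.2.1, hbm.1, fun j hj => ?_⟩
      by_contra! h
      have : j ∈ (k.1.erase a).erase c :=
        Finset.mem_erase.2 ⟨h.2.2, Finset.mem_erase.2 ⟨h.1, hj⟩⟩
      rw [hb, Finset.mem_singleton] at this
      exact h.2.1 this
    refine hG.not_adj_of_closed (hcl a ha b hb hba.symm) (fun h => hdisj a h ha)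
      (fun h => hdisj b h hb) (fun i hi j hij => ?_) hx hax (fun h => hdisj c h hc) hbc.symm
      (hcl a ha c hc hac)
    rcases hD i hi j hij with h | h
    · exact Or.inl h
    · rcases hk j h with h' | h' | h'
      · exact Or.inr (Or.inl h')
      · exact Or.inr (Or.inr h')
      · exact absurd (h' ▸ hij.symm) (hcD i hi)
  · push Not at hN
    obtain ⟨x, hx⟩ := hne
    have hreach : ∀ i j, G.Reachable i j → i ∈ D → j ∈ D := by
      rintro i j ⟨w⟩ hi
      induction w with
      | nil => exact hi
      | cons h w ih => exact ih ((hD _ hi _ h).resolve_right fun h' => hN _ h' _ hi h.symm)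
    have hxc : ¬ G.Reachable x c := fun h => hdisj c (hreach x c h hx) hc
    obtain ⟨w, hw, hwc⟩ : ∃ w ∈ k.1, w ≠ c :=
      Finset.exists_mem_ne (by rw [k.2.card_eq]; norm_num) c
    exact hG.2 x c (fun h => hxc (h ▸ .refl _)) (fun h => hxc h.reachable)
      (isPlanar_sup_edge_of_not_reachable hG.1 hxc ⟨w, hcl c hc w hw hwc.symm⟩)

/-! ### Two 3-cliques do not cross -/

theorem Divides.symm {k : Finset V} {S S' : Set V} (h : Divides G k S S') : Divides G k S' S where
  disjoint := h.disjoint.symm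
  union_eq := by rw [Set.union_comm, h.union_eq]
  meets i hi j hj p := by
    obtain ⟨v, hv, hk⟩ := h.meets j hj i hi p.reverse
    exact ⟨v, by simpa using hv, hk⟩

theorem Divides.notMem_left {k : Finset V} {S S' : Set V} (h : Divides G k S S') {x : V}
    (hx : x ∈ S) : x ∉ k := by
  have : x ∈ (k : Set V)ᶜ := h.union_eq ▸ Or.inl hx
  simpa using this

theorem Divides.notMem_right {k : Finset V} {S S' : Set V} (h : Divides G k S S') {x : V}
    (hx : x ∈ S') : x ∉ k := h.symm.notMem_left hx

theorem Divides.mem_or {k : Finset V} {S S' : Set V} (h : Divides G k S S') (x : V) :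
    x ∈ k ∨ x ∈ S ∨ x ∈ S' := by
  by_cases hx : x ∈ k
  · exact Or.inl hx
  · exact Or.inr (h.union_eq.ge (by simpa using hx))

theorem Divides.not_adj {k : Finset V} {S S' : Set V} (h : Divides G k S S') {x y : V}
    (hx : x ∈ S) (hy : y ∈ S') : ¬ G.Adj x y := by
  intro hxy
  obtain ⟨v, hv, hk⟩ := h.meets x hx y hy hxy.toWalk
  simp only [SimpleGraph.Walk.support_cons, SimpleGraph.Walk.support_nil,
    List.mem_cons, List.not_mem_nil, or_false] at hv
  rcases hv with rfl | rfl
  · exact h.notMem_left hx hk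
  · exact h.notMem_right hy hk

/-- A 3-clique lies on one side of any other one. -/
theorem Divides.clique_subset {k : Finset V} {S S' : Set V} (h : Divides G k S S')
    (l : Clique3 G) : (∀ x ∈ l.1, x ∈ k ∨ x ∈ S) ∨ (∀ x ∈ l.1, x ∈ k ∨ x ∈ S') := by
  by_contra! hc
  obtain ⟨⟨x, hx, hxk, hxS⟩, y, hy, hyk, hyS⟩ := hc
  have hx' : x ∈ S' := ((h.mem_or x).resolve_left hxk).resolve_left hxS
  have hy' : y ∈ S := ((h.mem_or y).resolve_left hyk).resolve_right hyS
  have hne : y ≠ x := fun h' => hxS (h' ▸ hy')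
  exact h.not_adj hy' hx' (l.2.isClique hy hx hne)

theorem Clique3.exists_notMem {k l : Clique3 G} (h : k ≠ l) : ∃ x ∈ l.1, x ∉ k.1 := by
  by_contra! hc
  exact h (Subtype.ext (Finset.eq_of_subset_of_card_le hc
    (by rw [k.2.card_eq, l.2.card_eq])).symm)

/-- If each of two distinct 3-cliques `k`, `l` lies on the first side of the other one, then
the second side of `l` lies in the first side of `k`. -/
theorem IsMaximalPlanar.side_subset [Finite V] (hG : IsMaximalPlanar G) {k l : Clique3 G}
    (hkl : k ≠ l) {S S' T T' : Set V} (hk : Divides G k.1 S S') (hl : Divides G l.1 T T')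
    (h1 : ∀ x ∈ l.1, x ∈ k.1 ∨ x ∈ S) (h2 : ∀ x ∈ k.1, x ∈ l.1 ∨ x ∈ T) : T' ⊆ S := by
  have hkT : ∀ x ∈ T', x ∉ k.1 := fun x hx hxk =>
    (h2 x hxk).elim (hl.notMem_right hx) fun h => Set.disjoint_left.1 hl.disjoint h hx
  -- The set `S' ∩ T'` is bounded by `l` alone, so a vertex of `l` outside `k`, which lies in `S`,
  -- would have a neighbour in `S'`.
  have hemp : ¬ (S' ∩ T').Nonempty := by
    intro hne
    obtain ⟨c, hc, hck⟩ := Clique3.exists_notMem hkl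
    have hclosed : ∀ i ∈ S' ∩ T', ∀ j, G.Adj i j → j ∈ S' ∩ T' ∨ j ∈ l.1 := by
      intro i hi j hij
      rcases hl.mem_or j with h | h | h
      · exact Or.inr h
      · exact absurd hij.symm (hl.not_adj h hi.2)
      · refine Or.inl ⟨?_, h⟩
        rcases hk.mem_or j with h' | h' | h'
        · exact absurd h' (hkT j h)
        · exact absurd hij.symm (hk.not_adj h' hi.1)
        · exact h'
    obtain ⟨x, hx, hcx⟩ := hG.exists_adj_of_closed l hne (fun i hi => hl.notMem_right hi.2)
      hclosed hc
    exact hk.not_adj ((h1 c hc).resolve_left hck) hx.1 hcx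
  intro x hx
  rcases hk.mem_or x with h | h | h
  · exact absurd h (hkT x hx)
  · exact h
  · exact absurd ⟨x, h, hx⟩ hemp

namespace Orientation

variable (o : Orientation G)

theorem mem_verts_closedInterior {k : Clique3 G} {x : V} :
    x ∈ (o.closedInterior k).verts ↔ x ∈ k.1 ∨ x ∈ o.interior k := by
  simp [closedInterior]

theorem le_iff {k l : Clique3 G} :
    o.le k l ↔ (o.closedInterior k).verts ⊆ (o.closedInterior l).verts :=
  ⟨fun h => h.1, fun h => SimpleGraph.Subgraph.induce_mono_right h⟩

theorem le_refl (k : Clique3 G) : o.le k k := _root_.le_refl _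

theorem le_trans {k l m : Clique3 G} (h : o.le k l) (h' : o.le l m) : o.le k m :=
  _root_.le_trans h h'

theorem clique_subset_verts (k : Clique3 G) : (k.1 : Set V) ⊆ (o.closedInterior k).verts :=
  fun _ hx => o.mem_verts_closedInterior.2 (Or.inl hx)

/-- Two 3-cliques each of which lies in the closed interior of the other one are equal. -/
theorem eq_of_mutual [Finite V] (hG : IsMaximalPlanar G) {k l : Clique3 G}
    (h1 : (l.1 : Set V) ⊆ (o.closedInterior k).verts)
    (h2 : (k.1 : Set V) ⊆ (o.closedInterior l).verts) : k = l := by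
  by_contra hkl
  have h1' : ∀ x ∈ l.1, x ∈ k.1 ∨ x ∈ o.interior k := fun x hx =>
    o.mem_verts_closedInterior.1 (h1 hx)
  have h2' : ∀ x ∈ k.1, x ∈ l.1 ∨ x ∈ o.interior l := fun x hx =>
    o.mem_verts_closedInterior.1 (h2 hx)
  have ha := hG.side_subset hkl (o.divides k) (o.divides l) h1' h2'
  have hb := hG.side_subset (Ne.symm hkl) (o.divides l) (o.divides k) h2' h1'
  obtain ⟨c, hc, hck⟩ := Clique3.exists_notMem hkl
  -- This yields the impossible chain |ext `l`| < |int `k`| ≤ |ext `k`| ≤ |int `l`| ≤ |ext `l`|. The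
  -- strict step comes from `c`, so ties between interior and exterior do no harm.
  have hss : o.exterior l ⊂ o.interior k :=
    ⟨ha, fun h => (o.divides l).notMem_right (h ((h1' c hc).resolve_left hck)) hc⟩
  have := Set.ncard_lt_ncard hss (Set.toFinite _)
  have := Set.ncard_le_ncard hb (Set.toFinite _)
  have := o.card_le k
  have := o.card_le l
  omega

theorem eq_of_le_of_le [Finite V] (hG : IsMaximalPlanar G) {k l : Clique3 G}
    (h1 : o.le k l) (h2 : o.le l k) : k = l :=
  o.eq_of_mutual hG ((o.clique_subset_verts l).trans (o.le_iff.1 h2))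
    ((o.clique_subset_verts k).trans (o.le_iff.1 h1))

/-- A 3-clique `l` in the closed interior of `k` is below `k`. -/
theorem le_of_subset [Finite V] (hG : IsMaximalPlanar G) {k l : Clique3 G}
    (h : (l.1 : Set V) ⊆ (o.closedInterior k).verts) : o.le l k := by
  by_cases hkl : k = l
  · rw [hkl]
    exact o.le_refl l
  have h1 : ∀ x ∈ l.1, x ∈ k.1 ∨ x ∈ o.interior k := fun x hx =>
    o.mem_verts_closedInterior.1 (h hx)
  rcases (o.divides l).clique_subset k with h2 | h2
  · exact absurd (o.eq_of_mutual hG h fun x hx => o.mem_verts_closedInterior.2 (h2 x hx)) hkl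
  -- Here `k` lies on the exterior side of `l`; with the two sides of `l` exchanged, it is the
  -- interior of `l` that is contained in that of `k`.
  · have := hG.side_subset hkl (o.divides k) (o.divides l).symm h1 h2
    rw [o.le_iff]
    intro x hx
    rcases o.mem_verts_closedInterior.1 hx with hx | hx
    · exact h hx
    · exact o.mem_verts_closedInterior.2 (Or.inr (this hx))

/-- Closed interiors form a laminar family. -/
theorem laminar [Finite V] (hG : IsMaximalPlanar G) (k l : Clique3 G) :
    o.le k l ∨ o.le l k ∨
      (o.closedInterior k).verts ∩ (o.closedInterior l).verts ⊆ (k.1 : Set V) := by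
  rcases (o.divides l).clique_subset k with h2 | h2
  · exact Or.inl (o.le_of_subset hG fun x hx => o.mem_verts_closedInterior.2 (h2 x hx))
  rcases (o.divides k).clique_subset l with h1 | h1
  · exact Or.inr (Or.inl (o.le_of_subset hG fun x hx => o.mem_verts_closedInterior.2 (h1 x hx)))
  by_cases hkl : k = l
  · exact Or.inl (hkl ▸ o.le_refl k)
  right; right
  rintro x ⟨hxk, hxl⟩
  -- Each clique lies on the exterior side of the other, so the interior of `k` is contained in the
  -- exterior of `l`.
  have hsub := hG.side_subset (Ne.symm hkl) (o.divides l).symm (o.divides k).symm h2 h1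
  rcases o.mem_verts_closedInterior.1 hxk with h | h
  · exact h
  · have hx := hsub h
    rcases o.mem_verts_closedInterior.1 hxl with h' | h'
    · exact absurd h' ((o.divides l).notMem_right hx)
    · exact absurd hx (Set.disjoint_left.1 (o.divides l).disjoint h')

/-! ### Bubbles and their roots -/

theorem mem_verts_graphUnion {A : Set (Clique3 G)} {x : V} :
    x ∈ (graphUnion A).verts ↔ ∃ k ∈ A, x ∈ k.1 := by
  simp [graphUnion]

theorem clique_subset_bubble (k : Clique3 G) : (k.1 : Set V) ⊆ (o.bubble k).verts :=
  fun _ hx => mem_verts_graphUnion.2 ⟨k, Set.mem_insert _ _, hx⟩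

theorem incoming_subset_bubble {k j : Clique3 G} (hj : j ∈ o.incoming k) :
    (j.1 : Set V) ⊆ (o.bubble k).verts :=
  fun _ hx => mem_verts_graphUnion.2 ⟨j, Set.mem_insert_of_mem _ hj, hx⟩

theorem bubble_subset (k : Clique3 G) : (o.bubble k).verts ⊆ (o.closedInterior k).verts := by
  intro x hx
  obtain ⟨j, hj, hxj⟩ := mem_verts_graphUnion.1 hx
  rcases hj with rfl | hj
  · exact o.clique_subset_verts _ hxj
  · exact o.le_iff.1 hj.1 (o.clique_subset_verts j hxj)

/-- Such a bubble contains two different 3-cliques, the root and one that it covers, so it has more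
than three vertices. -/
theorem not_bubble_subset_clique {k : Clique3 G} (hk : (o.incoming k).Nonempty) (l : Clique3 G) :
    ¬ (o.bubble k).verts ⊆ (l.1 : Set V) := by
  intro h
  obtain ⟨j, hj⟩ := hk
  have eq_of_subset : ∀ m : Clique3 G, (m.1 : Set V) ⊆ l.1 → m = l := fun m hm => by
    by_contra hne
    obtain ⟨x, hx, hx'⟩ := Clique3.exists_notMem (Ne.symm hne)
    exact hx' (hm hx)
  exact hj.2.1 ((eq_of_subset j ((o.incoming_subset_bubble hj).trans h)).trans
    (eq_of_subset k ((o.clique_subset_bubble k).trans h)).symm)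

/-! ### Maximal elements and uniqueness of roots -/

theorem exists_maximal_le [Finite V] (hG : IsMaximalPlanar G) {P : Clique3 G → Prop}
    {k : Clique3 G} (hk : P k) :
    ∃ m, P m ∧ o.le k m ∧ ∀ j, P j → o.le m j → j = m := by
  obtain ⟨m, ⟨hm, hkm⟩, hmax⟩ := Set.exists_max_image {m | P m ∧ o.le k m}
    (fun m => (o.closedInterior m).verts.ncard) (Set.toFinite _) ⟨k, hk, o.le_refl k⟩
  refine ⟨m, hm, hkm, fun j hj hmj => o.eq_of_le_of_le hG ?_ hmj⟩
  rw [o.le_iff, Set.eq_of_subset_of_ncard_le (o.le_iff.1 hmj)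
    (hmax j ⟨hj, o.le_trans hkm hmj⟩) (Set.toFinite _)]

theorem exists_incoming_above [Finite V] (hG : IsMaximalPlanar G) {k l : Clique3 G}
    (h : o.le l k) (hne : l ≠ k) : ∃ j ∈ o.incoming k, o.le l j := by
  obtain ⟨j, ⟨hjk, hj⟩, hlj, hmax⟩ :=
    o.exists_maximal_le hG (P := fun j => o.le j k ∧ j ≠ k) ⟨h, hne⟩
  refine ⟨j, ⟨hjk, hj, fun z hjz hzk => ?_⟩, hlj⟩
  by_cases hz : z = k
  · exact Or.inr hz
  · exact Or.inl (hmax z ⟨hzk, hz⟩ hjz)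

/-- If `l` were strictly below `k`, some `j` covered by `k` would lie above `l`. Then `k` is
contained in the common bubble, hence in the closed interior of `l` and in that of `j`, which forces
`k = j`. -/
theorem eq_of_le_of_bubble_eq [Finite V] (hG : IsMaximalPlanar G) {k l : Clique3 G}
    (hb : o.bubble k = o.bubble l) (h : o.le l k) : l = k := by
  by_contra hne
  obtain ⟨j, hj, hlj⟩ := o.exists_incoming_above hG h hne
  refine hj.2.1 (o.eq_of_le_of_le hG hj.1 (o.le_of_subset hG ?_))
  exact (o.clique_subset_bubble k).trans (hb ▸ (o.bubble_subset l).trans (o.le_iff.1 hlj))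

/-- A bubble has at most one root among the 3-cliques. -/
theorem eq_of_bubble_eq [Finite V] (hG : IsMaximalPlanar G) {k l : Clique3 G}
    (hk : (o.incoming k).Nonempty) (hb : o.bubble k = o.bubble l) : k = l := by
  rcases o.laminar hG k l with h | h | h
  · exact o.eq_of_le_of_bubble_eq hG hb.symm h
  · exact (o.eq_of_le_of_bubble_eq hG hb h).symm
  -- For incomparable roots the common bubble lies in both closed interiors, hence in `k`, which is
  -- too small.
  · exact absurd (fun x hx => h ⟨o.bubble_subset k hx, o.bubble_subset l (hb ▸ hx)⟩)
      (o.not_bubble_subset_clique hk k)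

/-- Let `m` be maximal above `k`. If the bubbles agreed, every maximal 3-clique would lie in the
closed interior of `m` and so equal `m`, and the bubble would be contained in `m`. -/
theorem bubble_ne_bubbleRho [Finite V] (hG : IsMaximalPlanar G) {k : Clique3 G}
    (hk : (o.incoming k).Nonempty) : o.bubble k ≠ o.bubbleRho := by
  intro hb
  obtain ⟨m, -, hkm, hmax⟩ := o.exists_maximal_le hG (P := fun _ => True) (k := k) trivial
  refine o.not_bubble_subset_clique hk m fun x hx => ?_
  obtain ⟨m', hm', hx'⟩ := mem_verts_graphUnion.1 (hb ▸ hx : x ∈ (o.bubbleRho).verts)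
  have hsub : (m'.1 : Set V) ⊆ (o.bubble k).verts := fun y hy =>
    hb ▸ mem_verts_graphUnion.2 ⟨m', hm', hy⟩
  rw [hm' m (o.le_of_subset hG (hsub.trans ((o.bubble_subset k).trans (o.le_iff.1 hkm))))]
  exact hx'

theorem root_unique [Finite V] (hG : IsMaximalPlanar G) {b : G.Subgraph}
    {r s : Option (Clique3 G)} (hr : o.IsRoot r b) (hs : o.IsRoot s b) : r = s := by
  rcases r with _ | k <;> rcases s with _ | l
  · rfl
  · exact absurd (hs.2.symm.trans hr) (o.bubble_ne_bubbleRho hG hs.1)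
  · exact absurd (hr.2.symm.trans hs) (o.bubble_ne_bubbleRho hG hr.1)
  · exact congrArg some (o.eq_of_bubble_eq hG hr.1 (hr.2.symm.trans hs.2))

theorem exists_root {b : G.Subgraph} (hb : b ∈ o.bubbles) : ∃ r, o.IsRoot r b := by
  rcases hb with ⟨k, hk⟩ | hb
  · exact ⟨some k, hk⟩
  · exact ⟨none, hb⟩

/-- Two roots which are below each other are roots of the same bubble. -/
theorem eq_of_le'_of_le' [Finite V] (hG : IsMaximalPlanar G) {b c : G.Subgraph}
    {r s : Option (Clique3 G)} (hr : o.IsRoot r b) (hs : o.IsRoot s c) (h : o.le' r s)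
    (h' : o.le' s r) : r = s := by
  -- A closed interior equal to `G` leaves the exterior empty, hence also the interior, which is no
  -- larger. Then `k` contains all vertices, too few for a bubble.
  have top : ∀ k : Clique3 G, (o.incoming k).Nonempty → ¬ (⊤ : G.Subgraph) ≤ o.closedInterior k := by
    intro k hk htop
    have hall : ∀ x, x ∈ k.1 ∨ x ∈ o.interior k := fun x =>
      o.mem_verts_closedInterior.1 (htop.1 (Set.mem_univ x))
    have hext : o.exterior k = ∅ := Set.eq_empty_of_forall_notMem fun x hx =>
      (hall x).elim ((o.divides k).notMem_right hx) fun h =>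
        Set.disjoint_left.1 (o.divides k).disjoint h hx
    have hint : o.interior k = ∅ := by
      have := o.card_le k
      rw [hext, Set.ncard_empty, Nat.le_zero, Set.ncard_eq_zero (Set.toFinite _)] at this
      exact this
    exact o.not_bubble_subset_clique hk k fun x _ => (hall x).resolve_right (by simp [hint])
  rcases r with _ | k <;> rcases s with _ | l
  · rfl
  · exact absurd h (top l hs.1)
  · exact absurd h' (top k hr.1)
  · exact congrArg some (o.eq_of_le_of_le hG h h')

theorem isRoot_injective {b c : o.bubbles} {r : Option (Clique3 G)} (hb : o.IsRoot r b.1)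
    (hc : o.IsRoot r c.1) : b = c := by
  rcases r with _ | k
  · exact Subtype.ext (hb.trans hc.symm)
  · exact Subtype.ext (hb.2.trans hc.2.symm)

theorem isPartialOrder_bubbleLE [Finite V] (hG : IsMaximalPlanar G) :
    IsPartialOrder o.bubbles o.bubbleLE where
  refl b := by
    obtain ⟨r, hr⟩ := o.exists_root b.2
    exact ⟨r, r, hr, hr, _root_.le_refl _⟩
  trans := by
    rintro a b c ⟨r, s, hr, hs, hrs⟩ ⟨s', t, hs', ht, hst⟩
    rw [o.root_unique hG hs' hs] at hst
    exact ⟨r, t, hr, ht, _root_.le_trans hrs hst⟩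
  antisymm := by
    rintro a b ⟨r, s, hr, hs, hrs⟩ ⟨s', r', hs', hr', hsr⟩
    rw [o.root_unique hG hs' hs, o.root_unique hG hr' hr] at hsr
    have := o.eq_of_le'_of_le' hG hr hs hrs hsr
    exact o.isRoot_injective hr (this ▸ hs)

theorem bubbleLE_rho (b : o.bubbles) : o.bubbleLE b o.rho := by
  obtain ⟨r, hr⟩ := o.exists_root b.2
  exact ⟨r, none, hr, rfl, le_top⟩

end Orientation

end CliqueHierarchy

theorem mainTheorem12 {V : Type*} [Finite V] (G : SimpleGraph V) (hV : 3 ≤ Nat.card V)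
    (hG : CliqueHierarchy.IsMaximalPlanar G) (o : CliqueHierarchy.Orientation G) :
    (∀ b ∈ o.bubbles, ∃! r, o.IsRoot r b) ∧
    IsPartialOrder o.bubbles o.bubbleLE ∧
    (∀ b : o.bubbles, (∀ c : o.bubbles, o.bubbleLE b c → c = b) ↔ b = o.rho) := by
  have hpo := o.isPartialOrder_bubbleLE hG
  refine ⟨fun b hb => ?_, hpo, fun b => ⟨fun h => ?_, ?_⟩⟩
  · obtain ⟨r, hr⟩ := o.exists_root hb
    exact ⟨r, hr, fun s hs => o.root_unique hG hs hr⟩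
  · exact (h o.rho (o.bubbleLE_rho b)).symm
  · rintro rfl c hc
    exact hpo.antisymm _ _ (o.bubbleLE_rho c) hc
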